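/- Let $n\ge 0$ and let $G(E,1)$ denote the space of lines through the origin of a Euclidean space $E$, with $\pi_S:E\to S$ the orthogonal projection onto a subspace $S$. A $1$-varifold in $E$ is a Radon measure $V$ on $G_1(E)=E\times G(E,1)$; its mass is the measure $|V|(A)=V(A\times G(E,1))$ on $E$. It is stationary if $\int \mathrm{div}_S g(x)\,dV(x,S)=0$ for every $g\in C_c^\infty(E,E)$, where $\mathrm{div}_S g(x)=\langle \partial_e g(x),e\rangle$ for a unit vector $e\in S$. Let $[V]$ be the set of points $x$ at which the density $\lim_{r\to0}|V|(B(x,r))/(2r)$ exists and lies in $(0,\infty)$. For a smooth map $f:E\to F$ of Euclidean spaces, $f_\sharp V$ is the Borel measure on $G_1(F)$ given by $$f_\sharp V(B)=\int_{\{(x,S):\,|Df(x)\circ\pi_S|\neq 0,\ (f(x),Df(x)(S))\in B\}}|Df(x)\circ\pi_S|\,dV(x,S).$$ Let $\mathrm{Var\,Tan}(V,x)$ be the set of $1$-varifolds $C$ in $E$ such that, for some $\lambda_i>0$ with $\lambda_i\to0$, $(\eta_{x,\lambda_i})_\sharp V\to C$ weakly (against $C_c(G_1(E))$), where $\eta_{x,\lambda}(y)=(y-x)/\lambda$.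 For a linear subspace $P$ of $E$, the projection image of $V$ is $(\pi_P)_\sharp V$, a Borel measure on $G_1(P)$, and the weighted projection of $V$ is the Borel measure on $G_1(P)$ $$(\pi_P)_{**}V(B)=\int_{\{(x,S):\,|\pi_P\circ\pi_S|\ne0,\ (\pi_P(x),\pi_P(S))\in B\}}|\pi_P\circ\pi_S|^2\,dV(x,S).$$ **Proposition 3.2.** Let $V$ be a stationary $1$-varifold in $\mathbb R^n$ and let $y\in[V]$. Then there is a stationary $1$-varifold $W$ in $\mathbb R^n$ such that $\mathrm{Var\,Tan}(V,y)=\mathrm{Var\,Tan}(W,y)$ and such that, for every linear subspace $P$ of $\mathbb R^n$ (of arbitrary dimension), the projection image $(\pi_P)_\sharp W$ is locally finite, and hence the weighted projection $(\pi_P)_{**}W$ is a stationary $1$-varifold in $P$. -/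

import Mathlib

open MeasureTheory Filter Topology
open scoped ENNReal RealInnerProductSpace

noncomputable section

namespace Varifold

/-- The Grassmannian `G(E, 1)` of lines through the origin of a Euclidean space `E`. -/
def Gr (E : Type*) [NormedAddCommGroup E] [InnerProductSpace ℝ E] : Type _ :=
  {S : Submodule ℝ E // Module.finrank ℝ S = 1}

lemma Gr.exists_unit {E : Type*} [NormedAddCommGroup E] [InnerProductSpace ℝ E] (S : Gr E) :
    ∃ e : E, e ∈ S.1 ∧ ‖e‖ = 1 := by
  have : Nontrivial S.1 := Module.nontrivial_of_finrank_pos (R := ℝ) (by rw [S.2]; norm_num)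
  obtain ⟨e, he⟩ := exists_norm_eq S.1 (zero_le_one)
  exact ⟨e, e.2, by simpa using he⟩

section Grassmannian

variable {E : Type*} [NormedAddCommGroup E] [InnerProductSpace ℝ E] [FiniteDimensional ℝ E]

/-- The orthogonal projection `π_S : E → E` onto the line `S`. -/
def Gr.proj (S : Gr E) : E →L[ℝ] E := S.1.starProjection

/-- The usual topology of the Grassmannian: the distance of two lines is the operator norm of the
difference of the orthogonal projections onto them. -/
instance instTopologicalSpaceGr : TopologicalSpace (Gr E) :=
  TopologicalSpace.induced Gr.proj inferInstance

instance instMeasurableSpaceGr : MeasurableSpace (Gr E) := borel (Gr E)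

instance instBorelSpaceGr : BorelSpace (Gr E) := ⟨rfl⟩

lemma Gr.continuous_proj : Continuous (Gr.proj : Gr E → E →L[ℝ] E) := continuous_induced_dom

lemma Gr.eq_span (S : Gr E) {e : E} (he : e ∈ S.1) (h1 : ‖e‖ = 1) :
    S.1 = Submodule.span ℝ {e} := by
  have h0 : e ≠ 0 := by rintro rfl; simp at h1
  symm
  apply Submodule.eq_of_le_of_finrank_eq
  · simpa [Submodule.span_singleton_le_iff_mem] using he
  · rw [finrank_span_singleton h0, S.2]

lemma Gr.proj_apply (S : Gr E) {e : E} (he : e ∈ S.1) (h1 : ‖e‖ = 1) (v : E) :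
    S.proj v = ⟪e, v⟫ • e := by
  obtain ⟨S, hS⟩ := S
  obtain rfl := Gr.eq_span ⟨S, hS⟩ he h1
  simp [Gr.proj, Submodule.starProjection_unit_singleton ℝ h1]

/-- The divergence of `g` at `x` along the line `S`, i.e. `tr (Dg(x) ∘ π_S)`; it equals
`⟨∂_e g (x), e⟩` for either unit vector `e` of `S`, see `divAlong_eq_inner`. -/
def divAlong (g : E → E) (x : E) (S : Gr E) : ℝ :=
  LinearMap.trace ℝ E ((fderiv ℝ g x ∘L S.proj : E →L[ℝ] E) : E →ₗ[ℝ] E)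

lemma divAlong_eq_inner (g : E → E) (x : E) (S : Gr E) {e : E} (he : e ∈ S.1) (h1 : ‖e‖ = 1) :
    divAlong g x S = ⟪fderiv ℝ g x e, e⟫ := by
  have : ((fderiv ℝ g x ∘L S.proj : E →L[ℝ] E) : E →ₗ[ℝ] E)
      = ((innerSL ℝ e : E →L[ℝ] ℝ) : E →ₗ[ℝ] ℝ).smulRight (fderiv ℝ g x e) := by
    ext v
    simp [Gr.proj_apply S he h1]
  rw [divAlong, this, LinearMap.trace_smulRight]
  simp [real_inner_comm]

end Grassmannian

/-- A 1-dimensional varifold in `E`: a Radon measure on `G₁(E) = E × G(E, 1)`, that is, a locally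
finite Borel measure (`E × G(E, 1)` is a locally compact separable metrizable space, so such a
measure is automatically regular). -/
structure OneVarifold (E : Type*) [NormedAddCommGroup E] [InnerProductSpace ℝ E]
    [FiniteDimensional ℝ E] [MeasurableSpace E] where
  /-- the measure on `E × G(E, 1)` -/
  measure : Measure (E × Gr E)
  locallyFinite : IsLocallyFiniteMeasure measure

section Basic

variable {E : Type*} [NormedAddCommGroup E] [InnerProductSpace ℝ E] [FiniteDimensional ℝ E]
  [MeasurableSpace E]

/-- The total mass `|V|`, the measure `A ↦ V (A × G(E, 1))` on `E`. -/
def OneVarifold.mass (V : OneVarifold E) : Measure E := V.measure.map Prod.fst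

/-- `[V]`: the points `x` where the 1-density `lim_{r → 0} |V|(B(x, r)) / (2 r)` exists and is
positive and finite (`2` is the length of the unit ball of `ℝ`). -/
def OneVarifold.densitySet (V : OneVarifold E) : Set E :=
  {x | ∃ θ : ℝ≥0∞, 0 < θ ∧ θ < ⊤ ∧
    Tendsto (fun r : ℝ => V.mass (Metric.ball x r) / ENNReal.ofReal (2 * r)) (𝓝[>] 0) (𝓝 θ)}

/-- The first variation `δV(g) = ∫ div_S g(x) dV(x, S)` of a measure on `E × G(E, 1)`. -/
def OneVarifold.firstVariation (V : OneVarifold E) (g : E → E) : ℝ :=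
  ∫ p, divAlong g p.1 p.2 ∂V.measure

/-- `V` is stationary in `E`: `δV(g) = 0` for all smooth compactly supported vector fields `g`. -/
def OneVarifold.IsStationary (V : OneVarifold E) : Prop :=
  ∀ g : E → E, ContDiff ℝ (⊤ : ℕ∞) g → HasCompactSupport g → V.firstVariation g = 0

end Basic

section Image

variable {E F : Type*}
  [NormedAddCommGroup E] [InnerProductSpace ℝ E] [FiniteDimensional ℝ E]
  [NormedAddCommGroup F] [InnerProductSpace ℝ F]

/-- `|Df(x) ∘ π_S|`, the operator norm (for lines, the norm on 1-vectors is this one). -/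
def jac (f : E → F) (p : E × Gr E) : ℝ := ‖fderiv ℝ f p.1 ∘L p.2.proj‖

lemma finrank_map_of_jac_ne_zero (f : E → F) (p : E × Gr E) (h : jac f p ≠ 0) :
    Module.finrank ℝ (p.2.1.map (fderiv ℝ f p.1 : E →ₗ[ℝ] F)) = 1 := by
  apply le_antisymm
  · exact (Submodule.finrank_map_le _ _).trans p.2.2.le
  · rw [Nat.one_le_iff_ne_zero]
    intro h0
    apply h
    rw [Submodule.finrank_eq_zero] at h0
    rw [jac, norm_eq_zero]
    ext v
    have : fderiv ℝ f p.1 (p.2.proj v) ∈ p.2.1.map (fderiv ℝ f p.1 : E →ₗ[ℝ] F) :=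
      Submodule.mem_map_of_mem (Submodule.starProjection_apply_mem _ _)
    rw [h0, Submodule.mem_bot] at this
    simpa using this

/-- The map `(x, S) ↦ (f(x), Df(x)(S))`, defined where `|Df(x) ∘ π_S| ≠ 0`. -/
def pushMap (f : E → F) (p : {p : E × Gr E // jac f p ≠ 0}) : F × Gr F :=
  (f p.1.1, ⟨p.1.2.1.map (fderiv ℝ f p.1.1 : E →ₗ[ℝ] F), finrank_map_of_jac_ne_zero f p.1 p.2⟩)

lemma continuous_jac (f : E → F) (hf : ContDiff ℝ 1 f) : Continuous (jac f) := by
  have h1 : Continuous (fun p : E × Gr E => fderiv ℝ f p.1) :=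
    (hf.continuous_fderiv one_ne_zero).comp continuous_fst
  have h2 : Continuous (fun p : E × Gr E => p.2.proj) :=
    Gr.continuous_proj.comp continuous_snd
  exact (h1.clm_comp h2).norm

variable [FiniteDimensional ℝ F]

lemma proj_pushMap (f : E → F) (p : {p : E × Gr E // jac f p ≠ 0}) :
    (pushMap f p).2.proj = (jac f p.1 ^ 2)⁻¹ •
      (fderiv ℝ f p.1.1 ∘L p.1.2.proj ∘L (fderiv ℝ f p.1.1).adjoint) := by
  obtain ⟨e, he, h1⟩ := p.1.2.exists_unit
  have hs := p.1.2.eq_span he h1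
  have hj : jac f p.1 = ‖fderiv ℝ f p.1.1 e‖ := by
    have : fderiv ℝ f p.1.1 ∘L p.1.2.proj
        = (innerSL ℝ e : E →L[ℝ] ℝ).smulRight (fderiv ℝ f p.1.1 e) := by
      ext v
      simp [Gr.proj_apply _ he h1]
    rw [jac, this, ContinuousLinearMap.norm_smulRight_apply, innerSL_apply_norm, h1, one_mul]
  have hm : (pushMap f p).2.1 = Submodule.span ℝ {fderiv ℝ f p.1.1 e} := by
    simp only [pushMap, hs]
    simp [Submodule.map_span]
  ext w
  have hsp : (pushMap f p).2.proj w
      = (Submodule.span ℝ {fderiv ℝ f p.1.1 e}).starProjection w := by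
    simp only [Gr.proj, hm]
  rw [hsp, Submodule.starProjection_singleton, hj]
  simp [Gr.proj_apply _ he h1, ContinuousLinearMap.adjoint_inner_right, smul_smul, div_eq_inv_mul]

lemma continuous_pushMap (f : E → F) (hf : ContDiff ℝ 1 f) : Continuous (pushMap f) := by
  have h1 : Continuous (fun p : {p : E × Gr E // jac f p ≠ 0} => fderiv ℝ f p.1.1) :=
    (hf.continuous_fderiv one_ne_zero).comp (continuous_fst.comp continuous_subtype_val)
  have h2 : Continuous (fun p : {p : E × Gr E // jac f p ≠ 0} => p.1.2.proj) :=
    Gr.continuous_proj.comp (continuous_snd.comp continuous_subtype_val)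
  have h3 : Continuous (fun p : {p : E × Gr E // jac f p ≠ 0} => (jac f p.1 ^ 2)⁻¹) :=
    (((continuous_jac f hf).comp continuous_subtype_val).pow 2).inv₀ fun p => pow_ne_zero 2 p.2
  refine (hf.continuous.comp (continuous_fst.comp continuous_subtype_val)).prodMk
    (continuous_induced_rng.2 ?_)
  have h4 : Continuous (fun p : {p : E × Gr E // jac f p ≠ 0} => (pushMap f p).2.proj) := by
    simp only [proj_pushMap]
    exact h3.smul (h1.clm_comp (h2.clm_comp
      ((ContinuousLinearMap.adjoint (𝕜 := ℝ) (E := E) (F := F)).continuous.comp h1)))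
  exact h4

variable [MeasurableSpace E] [MeasurableSpace F]

/-- The Borel measure `B ↦ ∫_{(x, S) : (f(x), Df(x)(S)) ∈ B} |Df(x) ∘ π_S|^m dμ(x, S)`
on `F × G(F, 1)`; see `weightedImage_apply`. -/
def weightedImage (m : ℕ) (f : E → F) (μ : Measure (E × Gr E)) : Measure (F × Gr F) :=
  ((μ.withDensity fun p => ENNReal.ofReal (jac f p ^ m)).comap
    (Subtype.val : {p : E × Gr E // jac f p ≠ 0} → E × Gr E)).map (pushMap f)

/-- For `f` of class `C¹`, `weightedImage m f μ` is given by the expected formula. -/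
lemma weightedImage_apply [BorelSpace E] [BorelSpace F] (m : ℕ) (f : E → F) (hf : ContDiff ℝ 1 f)
    (μ : Measure (E × Gr E)) {B : Set (F × Gr F)} (hB : MeasurableSet B) :
    weightedImage m f μ B =
      ∫⁻ p in {p | ∃ h : jac f p ≠ 0, pushMap f ⟨p, h⟩ ∈ B}, ENNReal.ofReal (jac f p ^ m) ∂μ := by
  have hS : MeasurableSet {p : E × Gr E | jac f p ≠ 0} :=
    (continuous_jac f hf).measurable (measurableSet_singleton (0 : ℝ)).compl
  have hm : Measurable (pushMap f) := (continuous_pushMap f hf).measurable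
  have him : (Subtype.val '' (pushMap f ⁻¹' B) : Set (E × Gr E))
      = {p | ∃ h : jac f p ≠ 0, pushMap f ⟨p, h⟩ ∈ B} := by
    ext p
    simp
  have hmi : MeasurableSet (Subtype.val '' (pushMap f ⁻¹' B) : Set (E × Gr E)) :=
    hS.subtype_image (hm hB)
  rw [weightedImage, Measure.map_apply hm hB]
  have hc := Measure.comap_apply (μ := μ.withDensity fun p => ENNReal.ofReal (jac f p ^ m))
    (Subtype.val : {p : E × Gr E // jac f p ≠ 0} → E × Gr E)
    Subtype.val_injective (fun s hs => hS.subtype_image hs) (hm hB)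
  rw [hc, withDensity_apply _ hmi, him]

/-- The image `f_♯ V` of a 1-varifold by a smooth map, as a Borel measure on `F × G(F, 1)`
(not necessarily locally finite). -/
def OneVarifold.image (f : E → F) (V : OneVarifold E) : Measure (F × Gr F) :=
  weightedImage 1 f V.measure

end Image

section Projections

variable {E : Type*} [NormedAddCommGroup E] [InnerProductSpace ℝ E] [FiniteDimensional ℝ E]
  [MeasurableSpace E]

/-- The projection image `(π_P)_♯ V`, a Borel measure on `P × G(P, 1)`. -/
def OneVarifold.projectionImage (V : OneVarifold E) (P : Submodule ℝ E) : Measure (P × Gr P) :=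
  V.image fun x => P.orthogonalProjectionOnto x

/-- The weighted projection `(π_P)_{**} V`, the Borel measure
`B ↦ ∫_{(x, S) : (π_P(x), π_P(S)) ∈ B} |π_P ∘ π_S|² dV(x, S)` on `P × G(P, 1)`. -/
def OneVarifold.weightedProjection (V : OneVarifold E) (P : Submodule ℝ E) :
    Measure (P × Gr P) :=
  weightedImage 2 (fun x => P.orthogonalProjectionOnto x) V.measure

/-- The dilatation `η_{x, t}(y) = (y - x) / t`. -/
def dilatation (x : E) (t : ℝ) (y : E) : E := t⁻¹ • (y - x)

/-- `Var Tan(V, x)`: the 1-varifolds `C` for which there are `t_i > 0`, `t_i → 0`, such that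
`(η_{x, t_i})_♯ V → C` weakly, i.e. against all continuous functions with compact support. -/
def OneVarifold.varTan (V : OneVarifold E) (x : E) : Set (OneVarifold E) :=
  {C | ∃ t : ℕ → ℝ, (∀ i, 0 < t i) ∧ Tendsto t atTop (𝓝 0) ∧
    ∀ φ : E × Gr E → ℝ, Continuous φ → HasCompactSupport φ →
      Tendsto (fun i => ∫ p, φ p ∂(V.image (dilatation x (t i)))) atTop (𝓝 (∫ p, φ p ∂C.measure))}

end Projections

end Varifold

end

open MeasureTheory Filter Topology
open scoped ENNReal RealInnerProductSpace

noncomputable section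

namespace Varifold

/-! ### The Grassmannian of lines and the Jacobian and divergence along a line. -/

section LineGeometry

variable {E F : Type*} [NormedAddCommGroup E] [InnerProductSpace ℝ E] [FiniteDimensional ℝ E]
  [NormedAddCommGroup F] [InnerProductSpace ℝ F]

/-! Tangent varifolds at `y` see only `V` near `y`, so `V` may be changed away from `y`. Cutting `V`
off by a radial function `χ = cutoff y` destroys stationarity: since `∇χ(x) = -c (x - y)` with `c ≥
0`, the first variation of `χ V` on `g` is `∫ ⟪g x, a⟫ dV`, where `a = c π_S(x - y)` is `rayField
y`. This defect is repaired by attaching to each `(x, S)` the ray `x + t a`, `t > 0`, with density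
`‖a‖` per length, hence `‖a‖² dt`. By the fundamental theorem of calculus its first variation is
`-⟪g x, a⟫` (`integral_Ioi_divAlong`), so the sum `W` is stationary (`isStationary_rayExtension`).
The rays start outside the unit ball and point away from `y`, so `W = V` in that ball
(`restrict_rayExtension`).

The gain is that a line meets a ball of radius `R` in length at most `2R`. A linear map `L` sends
each ray to a ray or a point, with mass in the ball at most a multiple of `‖a‖ R`, and `a` is
integrable because it has compact support. So every projection image of `W` is locally finite
(`lintegral_jac_rayExtension_lt_top`).

For the weighted projection, a test field `g` on `P` lifts to `g ∘ π_P` on the whole space, and the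
weight `|π_P ∘ π_S|²` is exactly what turns the divergence of `g` along `π_P(S)` into that of the
lift along `S` (`jac_sq_mul_divAlong_pushMap`). The lift lacks compact support; it is cut off at
larger and larger scales. Because `g` takes values in `P`, all divergences are dominated by a
multiple of `|π_P ∘ π_S|`, which is integrable over the cylinder above the support of `g`. -/

instance : SecondCountableTopology (Gr E) :=
  TopologicalSpace.secondCountableTopology_induced _ _ Gr.proj

/-- The line spanned by a unit vector. -/
def Gr.ofUnit (e : Metric.sphere (0 : E) 1) : Gr E :=
  ⟨Submodule.span ℝ {(e : E)}, finrank_span_singleton (ne_zero_of_mem_unit_sphere e)⟩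

lemma Gr.continuous_ofUnit : Continuous (Gr.ofUnit : Metric.sphere (0 : E) 1 → Gr E) := by
  refine continuous_induced_rng.2 ?_
  have h : (Gr.proj ∘ Gr.ofUnit : Metric.sphere (0 : E) 1 → E →L[ℝ] E)
      = fun e : Metric.sphere (0 : E) 1 =>
        (innerSL ℝ (e : E) : E →L[ℝ] ℝ).smulRight (e : E) := by
    funext e
    ext v
    have he : (e : E) ∈ (Gr.ofUnit e).1 := Submodule.mem_span_singleton_self _
    simp [Gr.proj_apply _ he (norm_eq_of_mem_sphere e)]
  rw [h]
  refine continuous_clm_apply.2 fun v => ?_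
  simp only [ContinuousLinearMap.smulRight_apply, innerSL_apply_apply]
  fun_prop

instance : CompactSpace (Gr E) := by
  refine ⟨?_⟩
  have h : Set.range (Gr.ofUnit : Metric.sphere (0 : E) 1 → Gr E) = Set.univ := by
    refine Set.range_eq_univ.2 fun S => ?_
    obtain ⟨e, he, h1⟩ := S.exists_unit
    exact ⟨⟨e, by simpa using h1⟩, Subtype.ext (S.eq_span he h1).symm⟩
  rw [← h]
  exact isCompact_range Gr.continuous_ofUnit

lemma Gr.proj_mem (S : Gr E) (v : E) : S.proj v ∈ S.1 := Submodule.starProjection_apply_mem _ _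

lemma Gr.proj_of_mem (S : Gr E) {v : E} (hv : v ∈ S.1) : S.proj v = v :=
  Submodule.starProjection_eq_self_iff.2 hv

lemma Gr.inner_proj_left (S : Gr E) (v w : E) : ⟪S.proj v, w⟫ = ⟪v, S.proj w⟫ :=
  Submodule.inner_starProjection_left_eq_right _ _ _

lemma jac_eq_norm (f : E → F) (p : E × Gr E) {e : E} (he : e ∈ p.2.1) (h1 : ‖e‖ = 1) :
    jac f p = ‖fderiv ℝ f p.1 e‖ := by
  have : fderiv ℝ f p.1 ∘L p.2.proj
      = (innerSL ℝ e : E →L[ℝ] ℝ).smulRight (fderiv ℝ f p.1 e) := by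
    ext v
    simp [Gr.proj_apply _ he h1]
  rw [jac, this, ContinuousLinearMap.norm_smulRight_apply, innerSL_apply_norm, h1, one_mul]

lemma jac_nonneg (f : E → F) (p : E × Gr E) : 0 ≤ jac f p := norm_nonneg _

/-- The Jacobian of a linear map along a line, evaluated on a vector of that line. -/
lemma norm_mul_jac (L : E →L[ℝ] F) (p : E × Gr E) {v : E} (hv : v ∈ p.2.1) :
    ‖v‖ * jac L p = ‖L v‖ := by
  obtain ⟨e, he, h1⟩ := p.2.exists_unit
  rw [jac_eq_norm _ p he h1, ContinuousLinearMap.fderiv]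
  rw [p.2.eq_span he h1] at hv
  obtain ⟨r, rfl⟩ := Submodule.mem_span_singleton.1 hv
  simp [norm_smul, h1]

lemma divAlong_eq_of_mem (g : E → E) (x : E) (S : Gr E) {v : E} (hv : v ∈ S.1) :
    ‖v‖ ^ 2 * divAlong g x S = ⟪fderiv ℝ g x v, v⟫ := by
  obtain ⟨e, he, h1⟩ := S.exists_unit
  rw [divAlong_eq_inner _ _ _ he h1]
  rw [S.eq_span he h1] at hv
  obtain ⟨r, rfl⟩ := Submodule.mem_span_singleton.1 hv
  simp [norm_smul, h1, inner_smul_left, inner_smul_right]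
  ring

lemma continuous_divAlong {g : E → E} (hg : ContDiff ℝ 1 g) :
    Continuous fun p : E × Gr E => divAlong g p.1 p.2 := by
  have h1 : Continuous (fun p : E × Gr E => fderiv ℝ g p.1) :=
    (hg.continuous_fderiv one_ne_zero).comp continuous_fst
  have h2 : Continuous (fun p : E × Gr E => p.2.proj) :=
    Gr.continuous_proj.comp continuous_snd
  have h3 : Continuous (LinearMap.trace ℝ E ∘ₗ ContinuousLinearMap.coeLM ℝ) :=
    LinearMap.continuous_of_finiteDimensional
      (LinearMap.trace ℝ E ∘ₗ (ContinuousLinearMap.coeLM ℝ : (E →L[ℝ] E) →ₗ[ℝ] E →ₗ[ℝ] E))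
  exact h3.comp (h1.clm_comp h2)

/-- Since the Grassmannian is compact, only the base point matters for compactness of supports on `E
× Gr E`. -/
lemma hasCompactSupport_of_fst {X Y Z : Type*} [TopologicalSpace X] [T2Space X] [TopologicalSpace Y]
    [T2Space Y] [CompactSpace Y] [Zero Z] {K : Set X} (hK : IsCompact K) {φ : X × Y → Z}
    (h : ∀ p : X × Y, p.1 ∉ K → φ p = 0) : HasCompactSupport φ :=
  HasCompactSupport.intro (hK.prod isCompact_univ) fun p hp => h p fun h' => hp ⟨h', trivial⟩

instance : T2Space (Gr E) := by
  have : Function.Injective (Gr.proj : Gr E → E →L[ℝ] E) := fun S T h =>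
    Subtype.ext (Submodule.starProjection_inj.1 h)
  exact T2Space.of_injective_continuous this Gr.continuous_proj

lemma divAlong_eq_zero_of_notMem {g : E → E} {x : E} (hx : x ∉ tsupport g) (S : Gr E) :
    divAlong g x S = 0 := by
  have : fderiv ℝ g x = 0 :=
    Function.notMem_support.1 fun h => hx (support_fderiv_subset ℝ h)
  simp [divAlong, this]

lemma hasCompactSupport_divAlong {g : E → E} (hg : HasCompactSupport g) :
    HasCompactSupport fun p : E × Gr E => divAlong g p.1 p.2 :=
  hasCompactSupport_of_fst hg fun p hp => divAlong_eq_zero_of_notMem hp p.2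

/-- Product rule. The last term is the error made by a cutoff: the attached rays cancel it for
`cutoff y`, and for `wideCutoff` it disappears in the limit. -/
lemma divAlong_smul {χ : E → ℝ} {g : E → E} (hχ : Differentiable ℝ χ) (hg : Differentiable ℝ g)
    (x : E) (S : Gr E) :
    divAlong (fun z => χ z • g z) x S
      = χ x * divAlong g x S + fderiv ℝ χ x (S.proj (g x)) := by
  obtain ⟨e, he, h1⟩ := S.exists_unit
  rw [divAlong_eq_inner _ _ _ he h1, divAlong_eq_inner _ _ _ he h1, Gr.proj_apply S he h1,
    fderiv_fun_smul (hχ x) (hg x)]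
  simp [inner_add_left, inner_smul_left, real_inner_comm]
  ring

end LineGeometry

/-! ### The radial cutoff and its tangential gradient. -/

section Cutoff

variable {E : Type*} [NormedAddCommGroup E]

/-- A smooth radial cutoff around `y`, equal to `1` on the unit ball. -/
def cutoff (y x : E) : ℝ := Real.smoothTransition (2 - ‖x - y‖ ^ 2)

/-- The factor `c ≥ 0` for which the gradient of `cutoff y` at `x` is `-c • (x - y)`. -/
def cutoffSlope (y x : E) : ℝ := 2 * deriv Real.smoothTransition (2 - ‖x - y‖ ^ 2)

lemma cutoff_nonneg (y x : E) : 0 ≤ cutoff y x := Real.smoothTransition.nonneg _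

lemma cutoff_le_one (y x : E) : cutoff y x ≤ 1 := Real.smoothTransition.le_one _

lemma cutoff_eq_one {y x : E} (h : ‖x - y‖ ≤ 1) : cutoff y x = 1 :=
  Real.smoothTransition.one_of_one_le (by nlinarith [norm_nonneg (x - y)])

lemma cutoff_eq_zero {y x : E} (h : 2 ≤ ‖x - y‖) : cutoff y x = 0 :=
  Real.smoothTransition.zero_of_nonpos (by nlinarith)

lemma continuous_cutoffSlope (y : E) : Continuous (cutoffSlope y) := by
  have h := (Real.smoothTransition.contDiff (n := 1)).continuous_deriv le_rfl
  exact continuous_const.mul (h.comp (by fun_prop))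

lemma cutoffSlope_nonneg (y x : E) : 0 ≤ cutoffSlope y x :=
  mul_nonneg zero_le_two Real.smoothTransition.monotone.deriv_nonneg

lemma cutoffSlope_eq_zero_of_lt {y x : E} (h : ‖x - y‖ < 1) : cutoffSlope y x = 0 := by
  have : Real.smoothTransition =ᶠ[𝓝 (2 - ‖x - y‖ ^ 2)] fun _ => 1 := by
    filter_upwards [Ioi_mem_nhds (show 1 < 2 - ‖x - y‖ ^ 2 by nlinarith [norm_nonneg (x - y)])]
      with s hs using Real.smoothTransition.one_of_one_le (le_of_lt hs)
  simp [cutoffSlope, this.deriv_eq]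

lemma cutoffSlope_eq_zero_of_two_le {y x : E} (h : 2 ≤ ‖x - y‖) : cutoffSlope y x = 0 := by
  have : Real.smoothTransition =ᶠ[𝓝 (2 - ‖x - y‖ ^ 2)] fun _ => 0 := by
    filter_upwards [Iio_mem_nhds (show 2 - ‖x - y‖ ^ 2 < 0 by nlinarith)]
      with s hs using Real.smoothTransition.zero_of_nonpos (le_of_lt hs)
  simp [cutoffSlope, this.deriv_eq]

variable [InnerProductSpace ℝ E]

lemma contDiff_cutoff (y : E) : ContDiff ℝ (⊤ : ℕ∞) (cutoff y) :=
  Real.smoothTransition.contDiff.comp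
    (contDiff_const.sub ((contDiff_id.sub contDiff_const).norm_sq ℝ))

lemma fderiv_cutoff (y x v : E) : fderiv ℝ (cutoff y) x v = -(cutoffSlope y x * ⟪x - y, v⟫) := by
  have h1 : HasFDerivAt (fun x : E => 2 - ‖x - y‖ ^ 2) (-(2 • innerSL ℝ (x - y))) x := by
    have := (((hasFDerivAt_id x).sub_const y).norm_sq).const_sub 2
    simpa using this
  have h2 : HasDerivAt Real.smoothTransition _ (2 - ‖x - y‖ ^ 2) :=
    ((Real.smoothTransition.contDiff (n := 1)).differentiable one_ne_zero _).hasDerivAt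
  have h3 := (h2.comp_hasFDerivAt x h1).fderiv
  have h4 : Real.smoothTransition ∘ (fun x : E => 2 - ‖x - y‖ ^ 2) = cutoff y := rfl
  rw [h4] at h3
  rw [h3]
  simp [cutoffSlope, inner_sub_left]
  ring

variable [FiniteDimensional ℝ E]

lemma hasCompactSupport_cutoff (y : E) : HasCompactSupport (cutoff y) :=
  HasCompactSupport.intro (isCompact_closedBall y 2) fun x hx => cutoff_eq_zero (by
    simp only [Metric.mem_closedBall, dist_eq_norm, not_le] at hx
    exact hx.le)

/-- The field of directions in which the varifold cut off by `cutoff y` is continued. -/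
def rayField (y : E) (p : E × Gr E) : E := cutoffSlope y p.1 • p.2.proj (p.1 - y)

lemma continuous_rayField (y : E) : Continuous (rayField y) :=
  ((continuous_cutoffSlope y).comp continuous_fst).smul
    ((Gr.continuous_proj.comp continuous_snd).clm_apply (by fun_prop))

lemma rayField_mem (y : E) (p : E × Gr E) : rayField y p ∈ p.2.1 :=
  Submodule.smul_mem _ _ (p.2.proj_mem _)

lemma hasCompactSupport_rayField (y : E) : HasCompactSupport (rayField y) :=
  hasCompactSupport_of_fst (isCompact_closedBall y 2) fun p hp => by
    simp only [Metric.mem_closedBall, dist_eq_norm, not_le] at hp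
    simp [rayField, cutoffSlope_eq_zero_of_two_le hp.le]

/-- This is why the rays have this direction: `rayField y` is minus the gradient of the cutoff along
the line. -/
lemma fderiv_cutoff_proj (y v : E) (p : E × Gr E) :
    fderiv ℝ (cutoff y) p.1 (p.2.proj v) = -⟪v, rayField y p⟫ := by
  rw [fderiv_cutoff, rayField, inner_smul_right, ← Gr.inner_proj_left, real_inner_comm]

/-- The rays in direction `rayField y` do not enter the unit ball around `y`. -/
lemma one_le_norm_ray {y : E} {p : E × Gr E} (h : rayField y p ≠ 0) {t : ℝ} (ht : 0 ≤ t) :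
    1 ≤ ‖p.1 + t • rayField y p - y‖ := by
  have h1 : 1 ≤ ‖p.1 - y‖ := by
    by_contra! h'
    exact h (by simp [rayField, cutoffSlope_eq_zero_of_lt h'])
  -- The direction makes no obtuse angle with `x - y`, because `⟪x - y, π_S(x - y)⟫ = ‖π_S(x -
  -- y)‖²`; so the distance from `y` never drops below its initial value.
  have h2 : 0 ≤ ⟪p.1 - y, t • rayField y p⟫ := by
    rw [rayField, inner_smul_right, inner_smul_right]
    refine mul_nonneg ht (mul_nonneg (cutoffSlope_nonneg _ _) ?_)
    have : ⟪p.1 - y, p.2.proj (p.1 - y)⟫ = ‖p.2.proj (p.1 - y)‖ ^ 2 := by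
      rw [← real_inner_self_eq_norm_sq, Gr.inner_proj_left, p.2.proj_of_mem (p.2.proj_mem _)]
    rw [this]
    positivity
  have h3 : p.1 + t • rayField y p - y = (p.1 - y) + t • rayField y p := by abel
  rw [h3]
  have h4 := norm_add_sq_real (p.1 - y) (t • rayField y p)
  nlinarith [norm_nonneg (p.1 - y + t • rayField y p), sq_nonneg ‖t • rayField y p‖]

end Cutoff

/-! ### Superpositions of rays and the mass of their linear images. -/

section Rays

lemma continuous_ray {E : Type*} [NormedAddCommGroup E] [InnerProductSpace ℝ E]
    [FiniteDimensional ℝ E] {a : E × Gr E → E} (ha : Continuous a) :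
    Continuous fun q : (E × Gr E) × ℝ => (q.1.1 + q.2 • a q.1, q.1.2) := by
  fun_prop

variable {E : Type*} [NormedAddCommGroup E] [InnerProductSpace ℝ E] [FiniteDimensional ℝ E]
  [MeasurableSpace E]

/-- The superposition of the rays `{x + t • a (x, S) | t > 0}`, each taken with density
`‖a (x, S)‖` with respect to length and with tangent line `S`, with respect to `μ`. -/
def rayMeasure (a : E × Gr E → E) (μ : Measure (E × Gr E)) : Measure (E × Gr E) :=
  ((μ.withDensity fun p => ENNReal.ofReal (‖a p‖ ^ 2)).prod (volume.restrict (Set.Ioi 0))).map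
    fun q : (E × Gr E) × ℝ => (q.1.1 + q.2 • a q.1, q.1.2)

variable [BorelSpace E]

lemma measurable_ray_density {a : E × Gr E → E} (ha : Continuous a) :
    Measurable fun p : E × Gr E => ENNReal.ofReal (‖a p‖ ^ 2) :=
  ENNReal.measurable_ofReal.comp (by fun_prop : Continuous fun p => ‖a p‖ ^ 2).measurable

lemma lintegral_rayMeasure {a : E × Gr E → E} (ha : Continuous a) (μ : Measure (E × Gr E))
    {φ : E × Gr E → ℝ≥0∞} (hφ : Measurable φ) :
    ∫⁻ p, φ p ∂(rayMeasure a μ) = ∫⁻ p, ENNReal.ofReal (‖a p‖ ^ 2) *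
      (∫⁻ t in Set.Ioi (0 : ℝ), φ (p.1 + t • a p, p.2)) ∂μ := by
  have hm := (continuous_ray ha).measurable
  have hφm : Measurable fun q : (E × Gr E) × ℝ => φ (q.1.1 + q.2 • a q.1, q.1.2) := hφ.comp hm
  rw [rayMeasure, lintegral_map hφ hm, lintegral_prod _ hφm.aemeasurable]
  exact lintegral_withDensity_eq_lintegral_mul _ (measurable_ray_density ha)
    hφm.lintegral_prod_right'

lemma integral_rayMeasure {a : E × Gr E → E} (ha : Continuous a) (μ : Measure (E × Gr E))
    [SFinite μ] {φ : E × Gr E → ℝ} (hφ : Continuous φ) (hi : Integrable φ (rayMeasure a μ)) :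
    ∫ p, φ p ∂(rayMeasure a μ) = ∫ p, ‖a p‖ ^ 2 *
      (∫ t in Set.Ioi (0 : ℝ), φ (p.1 + t • a p, p.2)) ∂μ := by
  have hm := (continuous_ray ha).measurable
  have hi' : Integrable (fun q : (E × Gr E) × ℝ => φ (q.1.1 + q.2 • a q.1, q.1.2))
      ((μ.withDensity fun p => ENNReal.ofReal (‖a p‖ ^ 2)).prod (volume.restrict (Set.Ioi 0))) :=
    (integrable_map_measure hφ.aestronglyMeasurable hm.aemeasurable).1 hi
  rw [rayMeasure, integral_map hm.aemeasurable hφ.aestronglyMeasurable, integral_prod _ hi',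
    integral_withDensity_eq_integral_toReal_smul (measurable_ray_density ha)
      (ae_of_all _ fun _ => ENNReal.ofReal_lt_top)]
  refine integral_congr_ae (ae_of_all _ fun p => ?_)
  simp

/-- Two parameters at which a line lies in a ball of radius `R` differ by at most `2R / ‖v‖`.
Centring an interval at one of them costs a factor of two over the sharp `2R`, which is harmless.
The bound is uniform in `v`, even as `v → 0`. -/
lemma ofReal_norm_mul_volume_le {F : Type*} [NormedAddCommGroup F] [NormedSpace ℝ F] (u v z : F)
    (R : ℝ) :
    ENNReal.ofReal ‖v‖ * volume {t : ℝ | ‖u + t • v - z‖ ≤ R} ≤ ENNReal.ofReal (4 * R) := by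
  rcases eq_or_ne v 0 with rfl | hv
  · simp
  rcases Set.eq_empty_or_nonempty {t : ℝ | ‖u + t • v - z‖ ≤ R} with h | ⟨s, hs⟩
  · simp [h]
  have hv' : 0 < ‖v‖ := norm_pos_iff.2 hv
  have hsub : {t : ℝ | ‖u + t • v - z‖ ≤ R} ⊆ Metric.closedBall s (2 * R / ‖v‖) := by
    intro t ht
    rw [Metric.mem_closedBall, Real.dist_eq, le_div_iff₀ hv', ← Real.norm_eq_abs, ← norm_smul]
    have : (t - s) • v = (u + t • v - z) - (u + s • v - z) := by rw [sub_smul]; abel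
    rw [this]
    have h1 : ‖u + t • v - z‖ ≤ R := ht
    have h2 : ‖u + s • v - z‖ ≤ R := hs
    linarith [norm_sub_le (u + t • v - z) (u + s • v - z)]
  calc ENNReal.ofReal ‖v‖ * volume {t : ℝ | ‖u + t • v - z‖ ≤ R}
      ≤ ENNReal.ofReal ‖v‖ * volume (Metric.closedBall s (2 * R / ‖v‖)) := by gcongr
    _ = ENNReal.ofReal (4 * R) := by
        rw [Real.volume_closedBall, ← ENNReal.ofReal_mul hv'.le]
        congr 1
        field_simp
        ring

/-- Linear images of a superposition of rays have finite mass over bounded sets. -/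
lemma lintegral_jac_rayMeasure_lt_top {F : Type*} [NormedAddCommGroup F] [InnerProductSpace ℝ F]
    {a : E × Gr E → E} (ha : Continuous a) (hc : HasCompactSupport a)
    (hmem : ∀ p, a p ∈ p.2.1) (μ : Measure (E × Gr E)) [IsLocallyFiniteMeasure μ]
    (L : E →L[ℝ] F) (z : F) (R : ℝ) :
    ∫⁻ p in {p : E × Gr E | ‖L p.1 - z‖ ≤ R}, ENNReal.ofReal (jac L p) ∂(rayMeasure a μ) < ⊤ := by
  have hcl : IsClosed {p : E × Gr E | ‖L p.1 - z‖ ≤ R} :=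
    isClosed_le (by fun_prop) continuous_const
  have hj : Measurable fun p : E × Gr E => ENNReal.ofReal (jac L p) :=
    ENNReal.measurable_ofReal.comp (continuous_jac L L.contDiff).measurable
  rw [← lintegral_indicator hcl.measurableSet,
    lintegral_rayMeasure ha μ (hj.indicator hcl.measurableSet)]
  have hint : ∫⁻ p, ENNReal.ofReal ‖a p‖ ∂μ < ⊤ := by
    have := (ha.integrable_of_hasCompactSupport (μ := μ) hc).hasFiniteIntegral
    simpa [HasFiniteIntegral, ofReal_norm] using this
  calc _ ≤ ∫⁻ p, ENNReal.ofReal ‖a p‖ * ENNReal.ofReal (4 * R) ∂μ := ?_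
    _ = (∫⁻ p, ENNReal.ofReal ‖a p‖ ∂μ) * ENNReal.ofReal (4 * R) :=
        lintegral_mul_const' _ _ ENNReal.ofReal_ne_top
    _ < ⊤ := ENNReal.mul_lt_top hint ENNReal.ofReal_lt_top
  refine lintegral_mono fun p => ?_
  -- The derivative of a linear map is constant, so the Jacobian does not change along a ray.
  have hjac : ∀ x : E, jac L (x, p.2) = jac L p := fun x => by simp [jac]
  have hset : MeasurableSet {t : ℝ | ‖L p.1 + t • L (a p) - z‖ ≤ R} :=
    (isClosed_le (by fun_prop) continuous_const).measurableSet
  calc _ ≤ ENNReal.ofReal (‖a p‖ ^ 2) * ∫⁻ t : ℝ,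
        {t : ℝ | ‖L p.1 + t • L (a p) - z‖ ≤ R}.indicator
          (fun _ => ENNReal.ofReal (jac L p)) t := by
        refine mul_le_mul' le_rfl ?_
        refine (setLIntegral_le_lintegral _ _).trans (lintegral_mono fun t => ?_)
        simp only [Set.indicator, Set.mem_ofPred_eq, hjac, map_add, map_smul]
        exact le_rfl
    -- One of the two factors `‖a p‖` combines with the Jacobian into the speed `‖L (a p)‖` of the
    -- image ray; the other remains for the integration in `p`.
    _ = ENNReal.ofReal ‖a p‖ * (ENNReal.ofReal ‖L (a p)‖ *
          volume {t : ℝ | ‖L p.1 + t • L (a p) - z‖ ≤ R}) := by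
        rw [lintegral_indicator_const hset, ← norm_mul_jac L p (hmem p),
          ENNReal.ofReal_mul (norm_nonneg _), ENNReal.ofReal_pow (norm_nonneg _)]
        ring
    _ ≤ _ := by gcongr; exact ofReal_norm_mul_volume_le _ _ _ _

end Rays

/-! ### The stationary extension by rays. -/

section Extension

/-- For `v` in `S`, `‖v‖² div_S g` at `x + t v` is the derivative in `t` of `⟪g (x + t v), v⟫`, so
only the endpoint `t = 0` contributes. -/
lemma integral_Ioi_divAlong {E : Type*} [NormedAddCommGroup E] [InnerProductSpace ℝ E]
    [FiniteDimensional ℝ E] {g : E → E} (hg : ContDiff ℝ 1 g) (hc : HasCompactSupport g)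
    (x : E) (S : Gr E) {v : E} (hv : v ∈ S.1) :
    ‖v‖ ^ 2 * ∫ t in Set.Ioi (0 : ℝ), divAlong g (x + t • v) S = -⟪g x, v⟫ := by
  rcases eq_or_ne v 0 with rfl | h0
  · simp
  have hv0 : 0 < ‖v‖ := norm_pos_iff.2 h0
  have hf : ContDiff ℝ 1 fun t : ℝ => ⟪g (x + t • v), v⟫ :=
    (hg.comp (contDiff_const.add (contDiff_id.smul contDiff_const))).inner ℝ contDiff_const
  have hs : HasCompactSupport fun t : ℝ => ⟪g (x + t • v), v⟫ := by
    obtain ⟨R, hR⟩ := hc.isBounded.subset_closedBall x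
    refine HasCompactSupport.intro (isCompact_closedBall 0 (R / ‖v‖)) fun t ht => ?_
    have : x + t • v ∉ tsupport g := fun h => ht (by
      have := hR h
      simp only [Metric.mem_closedBall, dist_eq_norm, add_sub_cancel_left, norm_smul] at this
      simpa [le_div_iff₀ hv0] using this)
    simp [image_eq_zero_of_notMem_tsupport this]
  have hd : ∀ t : ℝ, deriv (fun t : ℝ => ⟪g (x + t • v), v⟫) t
      = ‖v‖ ^ 2 * divAlong g (x + t • v) S := by
    intro t
    rw [divAlong_eq_of_mem g _ S hv]
    have h1 : HasDerivAt (fun t : ℝ => x + t • v) v t := by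
      simpa using ((hasDerivAt_id t).smul_const v).const_add x
    have h2 := ((hg.differentiable one_ne_zero (x + t • v)).hasFDerivAt.comp_hasDerivAt t h1)
    have h3 := h2.inner ℝ (hasDerivAt_const t v)
    simpa using h3.deriv
  have := hs.integral_Ioi_deriv_eq hf 0
  simp only [hd, integral_const_mul] at this
  simpa using this

variable {E : Type*} [NormedAddCommGroup E] [InnerProductSpace ℝ E] [FiniteDimensional ℝ E]
  [MeasurableSpace E]

/-- The restriction of `μ` to a neighbourhood of `y` by means of `cutoff y`, continued along rays
to infinity. -/
def rayExtension (y : E) (μ : Measure (E × Gr E)) : Measure (E × Gr E) :=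
  (μ.withDensity fun p => ENNReal.ofReal (cutoff y p.1)) + rayMeasure (rayField y) μ

variable [BorelSpace E]

lemma measurable_cutoff_density (y : E) :
    Measurable fun p : E × Gr E => ENNReal.ofReal (cutoff y p.1) :=
  ENNReal.measurable_ofReal.comp ((contDiff_cutoff y).continuous.comp continuous_fst).measurable

/-- The cut-off part has compact support and the rays are controlled one by one. Stated for any
linear `L`, this covers both the identity, which makes the extension a varifold, and all the
projections. -/
lemma lintegral_jac_rayExtension_lt_top {F : Type*} [NormedAddCommGroup F] [InnerProductSpace ℝ F]
    (y : E) (μ : Measure (E × Gr E)) [IsLocallyFiniteMeasure μ]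
    (L : E →L[ℝ] F) (z : F) (R : ℝ) :
    ∫⁻ p in {p : E × Gr E | ‖L p.1 - z‖ ≤ R}, ENNReal.ofReal (jac L p) ∂(rayExtension y μ) < ⊤ := by
  rw [rayExtension, Measure.restrict_add, lintegral_add_measure]
  refine ENNReal.add_lt_top.2 ⟨?_, lintegral_jac_rayMeasure_lt_top (continuous_rayField y)
    (hasCompactSupport_rayField y) (rayField_mem y) μ L z R⟩
  have hj : Continuous (jac (E := E) L) := continuous_jac L L.contDiff
  have hc : Continuous fun p : E × Gr E => cutoff y p.1 * jac L p :=
    ((contDiff_cutoff y).continuous.comp continuous_fst).mul hj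
  have hs : HasCompactSupport fun p : E × Gr E => cutoff y p.1 * jac L p :=
    hasCompactSupport_of_fst (hasCompactSupport_cutoff y) fun p hp => by
      simp [image_eq_zero_of_notMem_tsupport hp]
  have hi := (hc.integrable_of_hasCompactSupport (μ := μ) hs).lintegral_lt_top
  refine lt_of_le_of_lt (setLIntegral_le_lintegral _ _) ?_
  have hjm : Measurable fun p : E × Gr E => ENNReal.ofReal (jac L p) :=
    ENNReal.measurable_ofReal.comp hj.measurable
  rw [lintegral_withDensity_eq_lintegral_mul _ (measurable_cutoff_density y) hjm]
  simpa [ENNReal.ofReal_mul (cutoff_nonneg _ _)] using hi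

lemma isLocallyFinite_rayExtension (y : E) (μ : Measure (E × Gr E)) [IsLocallyFiniteMeasure μ] :
    IsLocallyFiniteMeasure (rayExtension y μ) := by
  refine ⟨fun p => ⟨{q | ‖q.1 - p.1‖ ≤ 1}, ?_, ?_⟩⟩
  · have : ∀ᶠ q : E × Gr E in 𝓝 p, ‖q.1 - p.1‖ < 1 :=
      (isOpen_lt (by fun_prop) continuous_const).mem_nhds (by simp)
    exact this.mono fun q hq => le_of_lt hq
  · have h := lintegral_jac_rayExtension_lt_top y μ (ContinuousLinearMap.id ℝ E) p.1 1
    have hj : ∀ q : E × Gr E, jac (ContinuousLinearMap.id ℝ E) q = 1 := fun q => by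
      obtain ⟨e, he, h1⟩ := q.2.exists_unit
      rw [jac_eq_norm _ q he h1, ContinuousLinearMap.fderiv]
      simpa using h1
    simp only [hj] at h
    simpa using h

/-- The varifold that agrees with `V` near `y` and consists of rays far from `y`. -/
def OneVarifold.rayExtension (V : OneVarifold E) (y : E) : OneVarifold E :=
  ⟨Varifold.rayExtension y V.measure,
    have := V.locallyFinite
    isLocallyFinite_rayExtension y V.measure⟩

/-- Stationarity of `V` is tested on `cutoff y • g`; the product rule then identifies the first
variation of the cut-off part with `∫ ⟪g, rayField y⟫`, the opposite of that of the rays. -/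
lemma isStationary_rayExtension (V : OneVarifold E) (hV : V.IsStationary) (y : E) :
    (V.rayExtension y).IsStationary := by
  intro g hg hc
  have := V.locallyFinite
  have hl := isLocallyFinite_rayExtension y V.measure
  have hg1 : ContDiff ℝ 1 g := hg.of_le (by exact_mod_cast le_top)
  have hdc := continuous_divAlong hg1
  have hi : Integrable (fun p : E × Gr E => divAlong g p.1 p.2)
      (Varifold.rayExtension y V.measure) :=
    hdc.integrable_of_hasCompactSupport (hasCompactSupport_divAlong hc)
  have hχc : Continuous fun p : E × Gr E => cutoff y p.1 :=
    (contDiff_cutoff y).continuous.comp continuous_fst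
  have hχg := hV (fun x => cutoff y x • g x) ((contDiff_cutoff y).smul hg) hc.smul_left
  rw [OneVarifold.firstVariation] at hχg ⊢
  have hsplit : ∀ p : E × Gr E, divAlong (fun x => cutoff y x • g x) p.1 p.2
      = cutoff y p.1 * divAlong g p.1 p.2 - ⟪g p.1, rayField y p⟫ := fun p => by
    rw [divAlong_smul ((contDiff_cutoff y).differentiable (by simp))
      (hg1.differentiable one_ne_zero), fderiv_cutoff_proj]
    rfl
  have hi1 : Integrable (fun p : E × Gr E => cutoff y p.1 * divAlong g p.1 p.2) V.measure :=
    (hχc.mul hdc).integrable_of_hasCompactSupport (hasCompactSupport_divAlong hc).mul_left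
  have hi2 : Integrable (fun p : E × Gr E => ⟪g p.1, rayField y p⟫) V.measure :=
    ((hg.continuous.comp continuous_fst).inner (continuous_rayField y)).integrable_of_hasCompactSupport
      (hasCompactSupport_of_fst hc fun p hp => by simp [image_eq_zero_of_notMem_tsupport hp])
  simp only [hsplit] at hχg
  rw [integral_sub hi1 hi2] at hχg
  rw [Varifold.rayExtension, integrable_add_measure] at hi
  change ∫ p : E × Gr E, divAlong g p.1 p.2 ∂(Varifold.rayExtension y V.measure) = 0
  rw [Varifold.rayExtension, integral_add_measure hi.1 hi.2,
    integral_withDensity_eq_integral_toReal_smul (measurable_cutoff_density y)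
      (ae_of_all _ fun _ => ENNReal.ofReal_lt_top),
    integral_rayMeasure (continuous_rayField y) _ hdc hi.2]
  simp only [integral_Ioi_divAlong hg1 hc _ _ (rayField_mem y _), integral_neg,
    ENNReal.toReal_ofReal (cutoff_nonneg _ _), smul_eq_mul]
  linarith

/-- The cutoff is `1` on the ball, and no ray of positive density enters it. -/
lemma restrict_rayExtension (y : E) (μ : Measure (E × Gr E)) :
    (rayExtension y μ).restrict (Metric.ball y 1 ×ˢ Set.univ)
      = μ.restrict (Metric.ball y 1 ×ˢ Set.univ) := by
  have hD : MeasurableSet (Metric.ball y 1 ×ˢ (Set.univ : Set (Gr E))) :=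
    Metric.isOpen_ball.measurableSet.prod .univ
  have h1 : (μ.withDensity fun p => ENNReal.ofReal (cutoff y p.1)).restrict
      (Metric.ball y 1 ×ˢ Set.univ) = μ.restrict (Metric.ball y 1 ×ˢ Set.univ) := by
    rw [restrict_withDensity hD]
    conv_rhs => rw [← withDensity_one (μ := μ.restrict (Metric.ball y 1 ×ˢ Set.univ))]
    refine withDensity_congr_ae ((ae_restrict_iff' hD).2 (ae_of_all _ fun p hp => ?_))
    have : ‖p.1 - y‖ < 1 := by simpa [dist_eq_norm] using hp
    simp [cutoff_eq_one this.le]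
  have h2 : (rayMeasure (rayField y) μ).restrict (Metric.ball y 1 ×ˢ Set.univ) = 0 := by
    rw [Measure.restrict_eq_zero, ← lintegral_indicator_one hD,
      lintegral_rayMeasure (continuous_rayField y) μ (measurable_one.indicator hD)]
    rw [← lintegral_zero (μ := μ)]
    congr 1
    funext p
    rcases eq_or_ne (rayField y p) 0 with h | h
    · simp [h]
    rw [mul_eq_zero]
    right
    rw [← lintegral_zero (μ := volume.restrict (Set.Ioi (0 : ℝ)))]
    refine setLIntegral_congr_fun measurableSet_Ioi fun t ht => ?_
    refine Set.indicator_of_notMem (fun h' => ?_) _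
    have h3 : ‖p.1 + t • rayField y p - y‖ < 1 := by simpa [dist_eq_norm] using h'.1
    exact absurd (one_le_norm_ray h (le_of_lt ht)) (not_le.2 h3)
  rw [rayExtension, Measure.restrict_add, h1, h2, add_zero]

end Extension

/-! ### Weighted images: locality, integration and local finiteness. -/

section WeightedImage

variable {E F : Type*}
  [NormedAddCommGroup E] [InnerProductSpace ℝ E] [FiniteDimensional ℝ E]
  [NormedAddCommGroup F] [InnerProductSpace ℝ F]

lemma jac_clm_le (L : E →L[ℝ] F) (p : E × Gr E) : jac L p ≤ ‖L‖ := by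
  obtain ⟨e, he, h1⟩ := p.2.exists_unit
  rw [jac_eq_norm _ p he h1, ContinuousLinearMap.fderiv]
  simpa [h1] using L.le_opNorm e

variable [MeasurableSpace E] [BorelSpace E]

lemma measurableSet_jac_ne_zero {f : E → F} (hf : ContDiff ℝ 1 f) :
    MeasurableSet {p : E × Gr E | jac f p ≠ 0} :=
  (continuous_jac f hf).measurable (measurableSet_singleton (0 : ℝ)).compl

variable [FiniteDimensional ℝ F] [MeasurableSpace F] [BorelSpace F]

/-- The part of a weighted image over `A` is determined by the part of the measure over `D`, if
`f` maps the complement of `D` to the complement of `A`. -/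
lemma restrict_weightedImage_congr (m : ℕ) {f : E → F} (hf : ContDiff ℝ 1 f)
    {μ ν : Measure (E × Gr E)} {D : Set E} {A : Set F}
    (hA : MeasurableSet A) (h : μ.restrict (D ×ˢ Set.univ) = ν.restrict (D ×ˢ Set.univ))
    (hDA : ∀ x, f x ∈ A → x ∈ D) :
    (weightedImage m f μ).restrict (A ×ˢ Set.univ)
      = (weightedImage m f ν).restrict (A ×ˢ Set.univ) := by
  ext B hB
  have hBA : MeasurableSet (B ∩ A ×ˢ (Set.univ : Set (Gr F))) := hB.inter (hA.prod .univ)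
  have hsub : {p | ∃ h : jac f p ≠ 0, pushMap f ⟨p, h⟩ ∈ B ∩ A ×ˢ (Set.univ : Set (Gr F))}
      ⊆ D ×ˢ (Set.univ : Set (Gr E)) := by
    rintro p ⟨_, hp⟩
    exact ⟨hDA _ hp.2.1, trivial⟩
  rw [Measure.restrict_apply hB, Measure.restrict_apply hB, weightedImage_apply m f hf μ hBA,
    weightedImage_apply m f hf ν hBA, ← Measure.restrict_restrict_of_subset hsub,
    ← Measure.restrict_restrict_of_subset (μ := ν) hsub, h]

/-- The weighted image forgets the lines collapsed by `f`, so the integrand upstairs has to vanish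
on them; this is `h0`. -/
lemma integral_weightedImage (m : ℕ) {f : E → F} (hf : ContDiff ℝ 1 f) (μ : Measure (E × Gr E))
    {φ : F × Gr F → ℝ} (hφ : Continuous φ) {ψ : E × Gr E → ℝ}
    (h0 : ∀ p, jac f p = 0 → ψ p = 0)
    (h : ∀ p (hp : jac f p ≠ 0), jac f p ^ m * φ (pushMap f ⟨p, hp⟩) = ψ p) :
    ∫ q, φ q ∂(weightedImage m f μ) = ∫ p, ψ p ∂μ := by
  have hS := measurableSet_jac_ne_zero hf
  rw [weightedImage, integral_map (continuous_pushMap f hf).measurable.aemeasurable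
    hφ.aestronglyMeasurable]
  classical
  have h1 : ∀ p : {p : E × Gr E // jac f p ≠ 0}, φ (pushMap f p)
      = (fun p : E × Gr E => if hp : jac f p ≠ 0 then φ (pushMap f ⟨p, hp⟩) else 0) p := fun p => by
    simp [p.2]
  rw [integral_congr_ae (ae_of_all _ h1)]
  refine (integral_subtype_comap hS
    (fun p : E × Gr E => if hp : jac f p ≠ 0 then φ (pushMap f ⟨p, hp⟩) else 0)).trans ?_
  refine (setIntegral_eq_integral_of_forall_compl_eq_zero (fun p hp => dif_neg hp)).trans ?_
  have hd : Measurable fun p : E × Gr E => ENNReal.ofReal (jac f p ^ m) :=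
    ENNReal.measurable_ofReal.comp ((continuous_jac f hf).pow m).measurable
  rw [integral_withDensity_eq_integral_toReal_smul hd (ae_of_all _ fun _ => ENNReal.ofReal_lt_top)]
  refine integral_congr_ae (ae_of_all _ fun p => ?_)
  dsimp only
  rw [ENNReal.toReal_ofReal (pow_nonneg (jac_nonneg f p) m), smul_eq_mul]
  split_ifs with hp
  · exact h p hp
  · rw [h0 p (not_not.1 hp), mul_zero]

/-- A contraction has Jacobian at most `1`, so its powers are bounded by the Jacobian itself. One
estimate thus serves both the image (`m = 1`) and the weighted projection (`m = 2`). -/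
lemma isLocallyFinite_weightedImage {m : ℕ} (hm : m ≠ 0) (L : E →L[ℝ] F) (hL : ‖L‖ ≤ 1)
    (μ : Measure (E × Gr E))
    (hμ : ∀ (z : F) (R : ℝ),
      ∫⁻ p in {p : E × Gr E | ‖L p.1 - z‖ ≤ R}, ENNReal.ofReal (jac L p) ∂μ < ⊤) :
    IsLocallyFiniteMeasure (weightedImage m L μ) := by
  refine ⟨fun q => ⟨Metric.closedBall q.1 1 ×ˢ Set.univ, ?_, ?_⟩⟩
  · exact prod_mem_nhds (Metric.closedBall_mem_nhds _ one_pos) univ_mem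
  rw [weightedImage_apply m L L.contDiff μ (Metric.isClosed_closedBall.measurableSet.prod .univ)]
  refine lt_of_le_of_lt ?_ (hμ q.1 1)
  refine (lintegral_mono_set ?_).trans (lintegral_mono fun p => ?_)
  · rintro p ⟨_, hp⟩
    have := hp.1
    rwa [Metric.mem_closedBall, dist_eq_norm] at this
  · exact ENNReal.ofReal_le_ofReal
      (pow_le_of_le_one (jac_nonneg _ _) ((jac_clm_le L p).trans hL) hm)

end WeightedImage

/-! ### Locality of tangent varifolds. -/

section TangentVarifolds

variable {E : Type*} [NormedAddCommGroup E] [InnerProductSpace ℝ E]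

lemma contDiff_dilatation (x : E) (t : ℝ) : ContDiff ℝ 1 (dilatation x t) :=
  contDiff_const.smul (contDiff_id.sub contDiff_const)

variable [FiniteDimensional ℝ E] [MeasurableSpace E] [BorelSpace E]

/-- Tangent varifolds at `y` only depend on the varifold near `y`. -/
lemma varTan_subset_of_restrict_eq {V W : OneVarifold E} {y : E} {r : ℝ} (hr : 0 < r)
    (h : V.measure.restrict (Metric.ball y r ×ˢ Set.univ)
      = W.measure.restrict (Metric.ball y r ×ˢ Set.univ)) :
    V.varTan y ⊆ W.varTan y := by
  rintro C ⟨t, ht, ht0, hC⟩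
  refine ⟨t, ht, ht0, fun φ hφ hc => (hC φ hφ hc).congr' ?_⟩
  obtain ⟨R, hR⟩ := (hc.image continuous_fst).isBounded.subset_closedBall (0 : E)
  -- The dilatation pulls the ball of radius `R` back to the ball of radius `R * t i` around `y`; `R
  -- + 1` leaves room for a strict inequality.
  have hlim : Tendsto (fun i => (R + 1) * t i) atTop (𝓝 0) := by
    simpa using ht0.const_mul (R + 1)
  filter_upwards [hlim.eventually_lt_const hr] with i hi
  have hvan : ∀ p ∉ Metric.closedBall (0 : E) R ×ˢ (Set.univ : Set (Gr E)), φ p = 0 :=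
    fun p hp => image_eq_zero_of_notMem_tsupport fun hp' =>
      hp ⟨hR (Set.mem_image_of_mem _ hp'), trivial⟩
  rw [← setIntegral_eq_integral_of_forall_compl_eq_zero hvan,
    ← setIntegral_eq_integral_of_forall_compl_eq_zero (μ := W.image _) hvan,
    OneVarifold.image, OneVarifold.image,
    restrict_weightedImage_congr 1 (contDiff_dilatation y (t i))
      Metric.isClosed_closedBall.measurableSet h]
  intro x hx
  rw [mem_closedBall_zero_iff, dilatation, norm_smul, norm_inv, Real.norm_of_nonneg (ht i).le,
    inv_mul_le_iff₀ (ht i)] at hx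
  rw [Metric.mem_ball, dist_eq_norm]
  nlinarith [ht i]

lemma varTan_eq_of_restrict_eq {V W : OneVarifold E} {y : E} {r : ℝ} (hr : 0 < r)
    (h : V.measure.restrict (Metric.ball y r ×ˢ Set.univ)
      = W.measure.restrict (Metric.ball y r ×ˢ Set.univ)) :
    V.varTan y = W.varTan y :=
  (varTan_subset_of_restrict_eq hr h).antisymm (varTan_subset_of_restrict_eq hr h.symm)

end TangentVarifolds

/-! ### Cutoffs at large scales. -/

section WideCutoff

variable {E : Type*} [NormedAddCommGroup E] [InnerProductSpace ℝ E]

/-- A rescaled cutoff around the origin. -/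
def wideCutoff (k : ℕ) (x : E) : ℝ := cutoff 0 (((k : ℝ) + 1)⁻¹ • x)

lemma contDiff_wideCutoff (k : ℕ) : ContDiff ℝ (⊤ : ℕ∞) (wideCutoff k : E → ℝ) :=
  (contDiff_cutoff 0).comp (contDiff_const.smul contDiff_id)

lemma fderiv_wideCutoff (k : ℕ) (x : E) :
    fderiv ℝ (wideCutoff k) x = ((k : ℝ) + 1)⁻¹ • fderiv ℝ (cutoff 0) (((k : ℝ) + 1)⁻¹ • x) := by
  unfold wideCutoff
  exact fderiv_comp_smul _

variable [FiniteDimensional ℝ E]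

lemma hasCompactSupport_wideCutoff (k : ℕ) : HasCompactSupport (wideCutoff k : E → ℝ) :=
  (hasCompactSupport_cutoff (0 : E)).comp_smul (inv_ne_zero k.cast_add_one_ne_zero)

/-- Boundedness uniform in `k` is enough, since integrability of the dominating function comes from
the Jacobian and not from decay of these gradients. -/
lemma exists_norm_fderiv_wideCutoff_le :
    ∃ C : ℝ, 0 ≤ C ∧ ∀ (k : ℕ) (x : E), ‖fderiv ℝ (wideCutoff k) x‖ ≤ C := by
  obtain ⟨C, hC⟩ := ((contDiff_cutoff (0 : E)).continuous_fderiv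
    (by simp)).bounded_above_of_compact_support ((hasCompactSupport_cutoff 0).fderiv ℝ)
  refine ⟨C, (norm_nonneg _).trans (hC 0), fun k x => ?_⟩
  rw [fderiv_wideCutoff, norm_smul, norm_inv, Real.norm_of_nonneg (by positivity)]
  refine (mul_le_of_le_one_left (norm_nonneg _) ?_).trans (hC _)
  exact inv_le_one_of_one_le₀ (by linarith [k.cast_nonneg (α := ℝ)])

lemma eventually_divAlong_wideCutoff {G : E → E} (hG : Differentiable ℝ G) (p : E × Gr E) :
    ∀ᶠ k : ℕ in atTop, divAlong (fun x => wideCutoff k x • G x) p.1 p.2 = divAlong G p.1 p.2 := by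
  filter_upwards [(tendsto_natCast_atTop_atTop (R := ℝ)).eventually_ge_atTop ‖p.1‖] with k hk
  have h : ‖((k : ℝ) + 1)⁻¹ • p.1 - 0‖ < 1 := by
    rw [sub_zero, norm_smul, norm_inv, Real.norm_of_nonneg (by positivity),
      inv_mul_lt_iff₀ (by positivity)]
    linarith
  rw [divAlong_smul ((contDiff_wideCutoff k).differentiable (by simp)) hG, fderiv_wideCutoff,
    wideCutoff, cutoff_eq_one h.le]
  simp [fderiv_cutoff, cutoffSlope_eq_zero_of_lt h]

end WideCutoff

/-! ### Stationarity of the weighted projection. -/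

section Projection

variable {E : Type*} [NormedAddCommGroup E] [InnerProductSpace ℝ E] [FiniteDimensional ℝ E]

/-- The vector field `x ↦ g (π_P x)` on `E`. -/
def liftField (P : Submodule ℝ E) (g : P → P) (x : E) : E := g (P.orthogonalProjectionOnto x)

lemma contDiff_liftField (P : Submodule ℝ E) {g : P → P} {n : WithTop ℕ∞} (hg : ContDiff ℝ n g) :
    ContDiff ℝ n (liftField P g) :=
  P.subtypeL.contDiff.comp (hg.comp P.orthogonalProjectionOnto.contDiff)

/-- A field with values in `P` sees a direction `e` only through its projection; this supplies the
Jacobian factor in the error term of the cutoff. -/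
lemma inner_coe_left (P : Submodule ℝ E) (u : P) (e : E) :
    ⟪(u : E), e⟫ = ⟪u, P.orthogonalProjectionOnto e⟫ := by
  rw [Submodule.inner_orthogonalProjectionOnto_eq_of_mem_left]

lemma divAlong_liftField (P : Submodule ℝ E) {g : P → P} (hg : Differentiable ℝ g) (x : E)
    (S : Gr E) {e : E} (he : e ∈ S.1) (h1 : ‖e‖ = 1) :
    divAlong (liftField P g) x S =
      ⟪fderiv ℝ g (P.orthogonalProjectionOnto x) (P.orthogonalProjectionOnto e),
        P.orthogonalProjectionOnto e⟫ := by
  have h : HasFDerivAt (liftField P g) (P.subtypeL ∘L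
      (fderiv ℝ g (P.orthogonalProjectionOnto x) ∘L P.orthogonalProjectionOnto)) x :=
    P.subtypeL.hasFDerivAt.comp x
      ((hg _).hasFDerivAt.comp x P.orthogonalProjectionOnto.hasFDerivAt)
  rw [divAlong_eq_inner _ _ _ he h1, h.fderiv, ← inner_coe_left]
  rfl

/-- The divergence is quadratic in the direction, and a unit vector of `S` projects to a vector of
length `jac`; hence the square in the weight. -/
lemma jac_sq_mul_divAlong_pushMap (P : Submodule ℝ E) {g : P → P} (hg : Differentiable ℝ g)
    (p : E × Gr E) (hp : jac P.orthogonalProjectionOnto p ≠ 0) :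
    jac P.orthogonalProjectionOnto p ^ 2 *
      divAlong g (pushMap P.orthogonalProjectionOnto ⟨p, hp⟩).1
        (pushMap P.orthogonalProjectionOnto ⟨p, hp⟩).2 = divAlong (liftField P g) p.1 p.2 := by
  obtain ⟨e, he, h1⟩ := p.2.exists_unit
  have hj := jac_eq_norm P.orthogonalProjectionOnto p he h1
  rw [ContinuousLinearMap.fderiv] at hj
  have hmem : P.orthogonalProjectionOnto e ∈
      (pushMap P.orthogonalProjectionOnto ⟨p, hp⟩).2.1 := by
    simp only [pushMap, ContinuousLinearMap.fderiv]
    exact Submodule.mem_map_of_mem he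
  rw [divAlong_liftField P hg p.1 p.2 he h1, hj, divAlong_eq_of_mem g _ _ hmem]
  rfl

variable [MeasurableSpace E] [BorelSpace E]

/-- A stationary varifold whose projection to `P` is locally finite satisfies the first variation
identity also for the fields lifted from `P`. -/
lemma integral_divAlong_liftField_eq_zero {W : OneVarifold E} (hW : W.IsStationary)
    (P : Submodule ℝ E)
    (hfin : ∀ (z : P) (R : ℝ), ∫⁻ p in {p : E × Gr E | ‖P.orthogonalProjectionOnto p.1 - z‖ ≤ R},
      ENNReal.ofReal (jac P.orthogonalProjectionOnto p) ∂W.measure < ⊤)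
    {g : P → P} (hg : ContDiff ℝ (⊤ : ℕ∞) g) (hc : HasCompactSupport g) :
    ∫ p, divAlong (liftField P g) p.1 p.2 ∂W.measure = 0 := by
  have hg1 : ContDiff ℝ 1 g := hg.of_le (by exact_mod_cast le_top)
  have hgd := hg1.differentiable one_ne_zero
  have hG := contDiff_liftField P hg
  have hG1 := contDiff_liftField P hg1
  have hGd := hG1.differentiable one_ne_zero
  obtain ⟨R, hR⟩ := hc.isBounded.subset_closedBall (0 : P)
  obtain ⟨C, hC0, hC⟩ := exists_norm_fderiv_wideCutoff_le (E := E)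
  obtain ⟨C₁, hC₁⟩ := (hg1.continuous_fderiv one_ne_zero).bounded_above_of_compact_support
    (hc.fderiv ℝ)
  obtain ⟨C₂, hC₂⟩ := hg1.continuous.bounded_above_of_compact_support hc
  set A : Set (E × Gr E) := {p | ‖P.orthogonalProjectionOnto p.1 - 0‖ ≤ R} with hA
  have hAm : MeasurableSet A :=
    (isClosed_le (by fun_prop) continuous_const).measurableSet
  have hjc : Continuous (jac (E := E) P.orthogonalProjectionOnto) :=
    continuous_jac _ P.orthogonalProjectionOnto.contDiff
  have hjint : IntegrableOn (jac P.orthogonalProjectionOnto) A W.measure :=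
    ⟨hjc.aestronglyMeasurable,
      (hasFiniteIntegral_iff_ofReal (ae_of_all _ fun p => jac_nonneg _ p)).2 (hfin 0 R)⟩
  -- `C₁` bounds the term with the derivative of `g`, where one of two Jacobian factors is estimated
  -- by `1`; `C * C₂` bounds the term with the gradient of the cutoff.
  have hbound : Integrable
      (A.indicator fun p => (C₁ + C * C₂) * jac P.orthogonalProjectionOnto p) W.measure :=
    (integrable_indicator_iff hAm).2 (hjint.const_mul _)
  have hzero : ∀ k : ℕ,
      ∫ p, divAlong (fun x => wideCutoff k x • liftField P g x) p.1 p.2 ∂W.measure = 0 :=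
    fun k => hW _ ((contDiff_wideCutoff k).smul hG) (hasCompactSupport_wideCutoff k).smul_right
  -- The integrals for the cut-off fields all vanish by stationarity, and at each point the
  -- integrands are eventually equal to the limit.
  refine tendsto_nhds_unique (tendsto_integral_of_dominated_convergence _ (fun k => ?_) hbound
    (fun k => ae_of_all _ fun p => ?_) (ae_of_all _ fun p =>
      tendsto_const_nhds.congr' ((eventually_divAlong_wideCutoff hGd p).mono fun k hk => hk.symm)))
    (by simp only [hzero]; exact tendsto_const_nhds)
  · exact (continuous_divAlong (((contDiff_wideCutoff k).of_le
      (by exact_mod_cast le_top)).smul hG1)).aestronglyMeasurable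
  obtain ⟨e, he, h1⟩ := p.2.exists_unit
  have hj := jac_eq_norm P.orthogonalProjectionOnto p he h1
  rw [ContinuousLinearMap.fderiv] at hj
  rw [divAlong_smul ((contDiff_wideCutoff k).differentiable (by simp)) hGd,
    divAlong_liftField P hgd p.1 p.2 he h1, Gr.proj_apply _ he h1, map_smul, smul_eq_mul,
    liftField, real_inner_comm _ e, inner_coe_left]
  by_cases hp : p ∈ A
  · rw [Set.indicator_of_mem hp, hj]
    set v := P.orthogonalProjectionOnto e
    set u := P.orthogonalProjectionOnto p.1
    have hv : ‖v‖ ≤ 1 := h1 ▸ P.norm_orthogonalProjectionOnto_apply_le e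
    have hC₁' : 0 ≤ C₁ := (norm_nonneg _).trans (hC₁ 0)
    have b1 : |⟪fderiv ℝ g u v, v⟫| ≤ C₁ * ‖v‖ := calc
      |⟪fderiv ℝ g u v, v⟫| ≤ ‖fderiv ℝ g u v‖ * ‖v‖ := abs_real_inner_le_norm _ _
      _ ≤ (C₁ * ‖v‖) * 1 := by
        gcongr
        exact (fderiv ℝ g u).le_of_opNorm_le (hC₁ u) v
      _ = C₁ * ‖v‖ := mul_one _
    have b2 : |⟪g u, v⟫| ≤ C₂ * ‖v‖ :=
      (abs_real_inner_le_norm _ _).trans (by gcongr; exact hC₂ u)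
    have b3 : |fderiv ℝ (wideCutoff k) p.1 e| ≤ C := by
      simpa [h1] using (fderiv ℝ (wideCutoff k) p.1).le_of_opNorm_le (hC k p.1) e
    have b4 : |wideCutoff k p.1| ≤ 1 := by
      rw [wideCutoff, abs_of_nonneg (cutoff_nonneg _ _)]
      exact cutoff_le_one _ _
    rw [Real.norm_eq_abs]
    calc _ ≤ |wideCutoff k p.1| * |⟪fderiv ℝ g u v, v⟫| +
          |⟪g u, v⟫| * |fderiv ℝ (wideCutoff k) p.1 e| := by
          rw [← abs_mul, ← abs_mul]
          exact abs_add_le _ _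
      _ ≤ 1 * (C₁ * ‖v‖) + (C₂ * ‖v‖) * C := by
          gcongr
          exact (abs_nonneg _).trans b2
      _ = _ := by ring
  -- Outside the cylinder `A` both the lifted field and its derivative vanish, whatever the cutoff.
  · have hn : P.orthogonalProjectionOnto p.1 ∉ tsupport g := fun h => hp (by
      simpa [hA] using hR h)
    have hfd : fderiv ℝ g (P.orthogonalProjectionOnto p.1) = 0 :=
      Function.notMem_support.1 fun h => hn (support_fderiv_subset ℝ h)
    simp [hp, hfd, image_eq_zero_of_notMem_tsupport hn]

/-- The weighted projection of a stationary varifold to `P` is a stationary varifold, if the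
projection image is locally finite. -/
lemma exists_isStationary_weightedProjection {W : OneVarifold E} (hW : W.IsStationary)
    (P : Submodule ℝ E)
    (hfin : ∀ (z : P) (R : ℝ), ∫⁻ p in {p : E × Gr E | ‖P.orthogonalProjectionOnto p.1 - z‖ ≤ R},
      ENNReal.ofReal (jac P.orthogonalProjectionOnto p) ∂W.measure < ⊤) :
    ∃ U : OneVarifold P, U.measure = W.weightedProjection P ∧ U.IsStationary := by
  refine ⟨⟨W.weightedProjection P, isLocallyFinite_weightedImage two_ne_zero
    P.orthogonalProjectionOnto P.orthogonalProjectionOnto_norm_le W.measure hfin⟩, rfl,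
    fun g hg hc => ?_⟩
  have hg1 : ContDiff ℝ 1 g := hg.of_le (by exact_mod_cast le_top)
  have hgd := hg1.differentiable one_ne_zero
  rw [← integral_divAlong_liftField_eq_zero hW P hfin hg hc]
  refine integral_weightedImage 2 P.orthogonalProjectionOnto.contDiff W.measure
    (continuous_divAlong hg1) (fun p hp => ?_) (jac_sq_mul_divAlong_pushMap P hgd)
  obtain ⟨e, he, h1⟩ := p.2.exists_unit
  rw [jac_eq_norm _ p he h1, ContinuousLinearMap.fderiv, norm_eq_zero] at hp
  rw [divAlong_liftField P hgd p.1 p.2 he h1, hp, inner_zero_right]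

end Projection

end Varifold

end

theorem proposition3p2 (n : ℕ) (V : Varifold.OneVarifold (EuclideanSpace ℝ (Fin n)))
    (hV : V.IsStationary) (y : EuclideanSpace ℝ (Fin n)) (hy : y ∈ V.densitySet) :
    ∃ W : Varifold.OneVarifold (EuclideanSpace ℝ (Fin n)),
      W.IsStationary ∧
      V.varTan y = W.varTan y ∧
      ∀ P : Submodule ℝ (EuclideanSpace ℝ (Fin n)),
        IsLocallyFiniteMeasure (W.projectionImage P) ∧
        ∃ U : Varifold.OneVarifold P, U.measure = W.weightedProjection P ∧ U.IsStationary := by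
  have := V.locallyFinite
  have hW := Varifold.isStationary_rayExtension V hV y
  refine ⟨V.rayExtension y, hW, Varifold.varTan_eq_of_restrict_eq one_pos
    (Varifold.restrict_rayExtension y V.measure).symm, fun P => ?_⟩
  have hfin := Varifold.lintegral_jac_rayExtension_lt_top y V.measure P.orthogonalProjectionOnto
  exact ⟨Varifold.isLocallyFinite_weightedImage one_ne_zero _
    P.orthogonalProjectionOnto_norm_le _ hfin,
    Varifold.exists_isStationary_weightedProjection hW P hfin⟩
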